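/- **Setting.** A cellular network has $n$ base stations. Cell $i$ serves a nonempty finite group $\mathcal J_i$ of users of its own, and $g_{kj}>0$ denotes the channel gain from base station $k$ to user $j$. For a cell-level demand vector $d=(d_1,\dots,d_n)>0$ (every user of cell $i$ is served the demand $d_i$) let $\Lambda(d)$ be the real $n\times n$ matrix with zero diagonal and with entries $$\lambda_{ik}=\sum_{j\in\mathcal J_i}\frac{g_{kj}\,d_i}{g_{ij}}\qquad(i\ne k),$$ and let $r(\cdot)$ denote the spectral radius. The utility function $U$ on $(0,\infty)$ is one of $$\mathsf{LIN}:\ U(d)=d,\qquad \mathsf{LOG}:\ U(d)=\log d,\qquad \mathsf{DLOG}:\ U(d)=\log(\log(1+d)).$$ Let $\mathcal Y^n$ be the set of positive vectors in $\mathbb R^n$ for $\mathsf{LIN}$, and $\mathcal Y^n=\mathbb R^n$ for $\mathsf{LOG}$ and $\mathsf{DLOG}$. The transformed feasibility set and its complement are $$\widetilde{\mathcal F}=\{y\in\mathcal Y^n:\ r(\Lambda(U^{-1}(y_1),\dots,U^{-1}(y_n)))<1\},\qquad \widetilde{\mathcal F}^c=\mathcal Y^n\setminus\widetilde{\mathcal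 F}.$$ A set is called strictly convex here if the open segment between any two distinct points of its closure lies in its interior (so it is convex and its boundary contains no line segment). **Theorem.** - $\mathsf{LIN}$ utility: for $n=2$, $\widetilde{\mathcal F}^c$ is convex for every network. For larger $n$ it is in general not convex: for every $n\ge 4$ and all prescribed numbers $|\mathcal J_1|,\dots,|\mathcal J_n|\ge 1$ of users there are positive channel gains for which $\widetilde{\mathcal F}^c$ is not convex. (In particular, it is not true that $\widetilde{\mathcal F}^c$ is convex for all networks with $n\ge 3$ base stations.) - $\mathsf{LOG}$ utility: $\widetilde{\mathcal F}$ is convex for every network with $n=2$, and strictly convex for every network with $n\ge 3$. - $\mathsf{DLOG}$ utility: $\widetilde{\mathcal F}$ is strictly convex for every network with $n\ge 2$. -/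

import Mathlib

/-- A cellular network with base stations `0, …, n-1`. Cell `i` serves a group of `numUsers i ≥ 1`
users of its own, and `gain k i j > 0` is the channel gain from base station `k` to user `j` of
cell `i`. -/
structure CellularNetwork (n : ℕ) where
  numUsers : Fin n → ℕ
  numUsers_pos : ∀ i, 0 < numUsers i
  gain : Fin n → (i : Fin n) → Fin (numUsers i) → ℝ
  gain_pos : ∀ k i j, 0 < gain k i j

/-- The load-coupling matrix `Λ(d)` for the user demands `d i j`: zero diagonal, and the entry
`∑ j, g_{kj} d_{ij} / g_{ij}` (sum over the users `j` of cell `i`) at `(i, k)` with `i ≠ k`. -/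
noncomputable def CellularNetwork.couplingMatrix {n : ℕ} (N : CellularNetwork n)
    (d : (i : Fin n) → Fin (N.numUsers i) → ℝ) : Matrix (Fin n) (Fin n) ℝ :=
  Matrix.of fun i k => if i = k then 0 else ∑ j, N.gain k i j * d i j / N.gain i i j

/-- `Λ` at a cell-level demand vector: every user of cell `i` is served the same demand `d i`. -/
noncomputable def CellularNetwork.cellCouplingMatrix {n : ℕ} (N : CellularNetwork n)
    (d : Fin n → ℝ) : Matrix (Fin n) (Fin n) ℝ :=
  N.couplingMatrix fun i _ => d i

/-- The spectral radius of a real square matrix: the largest modulus of a complex eigenvalue. -/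
noncomputable def matrixSpectralRadius {n : ℕ} (A : Matrix (Fin n) (Fin n) ℝ) : ENNReal :=
  spectralRadius ℂ (A.map (fun x : ℝ => (x : ℂ)))

/-- The three kinds of utility function. -/
inductive Utility where
  | LIN
  | LOG
  | DLOG

/-- The utility `U(d)` of a demand `d > 0`. -/
noncomputable def Utility.U : Utility → ℝ → ℝ
  | .LIN, d => d
  | .LOG, d => Real.log d
  | .DLOG, d => Real.log (Real.log (1 + d))

/-- The set of values of `U` on positive demands: the positive reals for `LIN`, all reals for
`LOG` and `DLOG`. -/
def Utility.range : Utility → Set ℝ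
  | .LIN => Set.Ioi 0
  | .LOG => Set.univ
  | .DLOG => Set.univ

/-- The inverse `g = U⁻¹` of the utility function, see `Utility.bijOn_U` and `Utility.invOn_g`. -/
noncomputable def Utility.g : Utility → ℝ → ℝ
  | .LIN, y => y
  | .LOG, y => Real.exp y
  | .DLOG, y => Real.exp (Real.exp y) - 1

theorem Utility.mapsTo_U (u : Utility) : Set.MapsTo u.U (Set.Ioi 0) u.range := by
  cases u <;> intro d hd
  · exact hd
  · trivial
  · trivial

theorem Utility.mapsTo_g (u : Utility) : Set.MapsTo u.g u.range (Set.Ioi 0) := by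
  cases u <;> intro y hy
  · exact hy
  · exact Real.exp_pos y
  · simp [Utility.g, Real.exp_pos]

/-- `g` is the two-sided inverse of `U` between the positive reals and the range of `U`. -/
theorem Utility.invOn_g (u : Utility) : Set.InvOn u.g u.U (Set.Ioi 0) u.range := by
  cases u <;> refine ⟨fun d hd => ?_, fun y hy => ?_⟩
  · rfl
  · rfl
  · exact Real.exp_log hd
  · exact Real.log_exp y
  · have hd' : (0 : ℝ) < d := hd
    have h : 0 < Real.log (1 + d) := Real.log_pos (by linarith)
    simp only [Utility.g, Utility.U]
    rw [Real.exp_log h, Real.exp_log (by linarith)]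
    ring
  · simp [Utility.g, Utility.U]

theorem Utility.bijOn_U (u : Utility) : Set.BijOn u.U (Set.Ioi 0) u.range :=
  u.invOn_g.bijOn u.mapsTo_U u.mapsTo_g

/-- `𝒴ⁿ`: the vectors all of whose entries are values of the utility function. -/
def Utility.vectors (u : Utility) (n : ℕ) : Set (Fin n → ℝ) :=
  {y | ∀ i, y i ∈ u.range}

/-- The transformed feasibility set `{y ∈ 𝒴ⁿ : r(Λ(g(y))) < 1}`. -/
def CellularNetwork.feasibilitySet {n : ℕ} (N : CellularNetwork n) (u : Utility) :
    Set (Fin n → ℝ) :=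
  {y | y ∈ u.vectors n ∧ matrixSpectralRadius (N.cellCouplingMatrix fun i => u.g (y i)) < 1}

/-- The complement of the transformed feasibility set in `𝒴ⁿ`. -/
def CellularNetwork.infeasibilitySet {n : ℕ} (N : CellularNetwork n) (u : Utility) :
    Set (Fin n → ℝ) :=
  u.vectors n \ N.feasibilitySet u

/-- Strict convexity of a region that need not contain its boundary: the open segment between any
two distinct points of the closure lies in the interior. In particular the region is convex and
its boundary contains no line segment. (For open sets, `StrictConvex` is no stronger than
`Convex`, as it only tests pairs of points of the set itself.) -/
def IsStrictlyConvexRegion {E : Type*} [TopologicalSpace E] [AddCommGroup E] [Module ℝ E]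
    (S : Set E) : Prop :=
  ∀ x ∈ closure S, ∀ y ∈ closure S, x ≠ y → openSegment ℝ x y ⊆ interior S

/-! A nonnegative matrix `A` has spectral radius below one iff `A x < x` entrywise for some positive
`x` (`matrixSpectralRadius_lt_one_iff`). Feasibility thus becomes solvability of `g (y i) * ∑ k, c i
k * x k < x i`, with `c` the coupling coefficients.

For `LIN` and two cells, `x` can be eliminated, leaving a bound on `y 0 * y 1`; for `n ≥ 4`, two
almost decoupled pairs of cells destroy convexity.

For `LOG` and `DLOG`, write `g = exp ∘ h` with `h` convex and `x = exp v`. The conditions read `∑ k,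
c i k * exp (h (y i) + v k - v i) < 1`, jointly convex in `(y, v)`, so the projection to `y` is
convex. For strict convexity, closure points still have a `v` with nonstrict inequalities, and
strictness in a single row suffices, because positive off-diagonal coupling spreads it to all rows.
That one strict row comes from `exp` for `LOG` with `n ≥ 3`, and from strict convexity of `h` for
`DLOG`. -/

open Filter Topology
open scoped Matrix

/-! ### Spectral radius and strictly decreased positive vectors -/

section SpectralRadius

open scoped Matrix.Norms.Operator

/-- A nonnegative square matrix with spectral radius less than one admits a positive vector which
it strictly decreases. -/
theorem exists_pos_mulVec_lt_of_matrixSpectralRadius_lt_one {n : ℕ}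
    {A : Matrix (Fin n) (Fin n) ℝ} (hA : ∀ i k, 0 ≤ A i k) (hr : matrixSpectralRadius A < 1) :
    ∃ x : Fin n → ℝ, (∀ i, 0 < x i) ∧ ∀ i, (A *ᵥ x) i < x i := by
  have hlim := spectrum.pow_nnnorm_pow_one_div_tendsto_nhds_spectralRadius
    (A.map (fun x : ℝ => (x : ℂ)))
  obtain ⟨m, hm1, hm⟩ := ((hlim.eventually_lt_const hr).and (eventually_ge_atTop 1)).exists
  have hm0 : (0 : ℝ) < m := by exact_mod_cast hm
  have hnorm : ‖(A.map (fun x : ℝ => (x : ℂ))) ^ m‖ < 1 := by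
    by_contra! hge
    refine absurd hm1 (not_lt.mpr ?_)
    have h1 : (1 : ENNReal) ≤ (‖(A.map (fun x : ℝ => (x : ℂ))) ^ m‖₊ : ENNReal) := by
      exact_mod_cast hge
    exact ENNReal.one_le_rpow h1 (by positivity)
  have hpow : (A.map (fun x : ℝ => (x : ℂ))) ^ m = (A ^ m).map (fun x : ℝ => (x : ℂ)) :=
    (map_pow (Complex.ofRealHom.mapMatrix) A m).symm
  have hsmall : ∀ i, ((A ^ m) *ᵥ 1) i < 1 := by
    intro i
    have h1 : (((A ^ m) *ᵥ 1) i : ℂ) = ((A ^ m).map (fun x : ℝ => (x : ℂ)) *ᵥ 1) i := by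
      simp [Matrix.mulVec, dotProduct]
    have h2 := Matrix.linfty_opNorm_mulVec ((A.map (fun x : ℝ => (x : ℂ))) ^ m) 1
    have h3 : ‖(1 : Fin n → ℂ)‖ ≤ 1 := (pi_norm_le_iff_of_nonneg zero_le_one).2 (by simp)
    have h4 := norm_le_pi_norm ((A.map (fun x : ℝ => (x : ℂ))) ^ m *ᵥ 1) i
    have h5 : ‖(((A ^ m) *ᵥ 1) i : ℂ)‖ < 1 := by
      rw [h1, ← hpow]
      nlinarith [norm_nonneg ((A.map (fun x : ℝ => (x : ℂ))) ^ m)]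
    rw [Complex.norm_real] at h5
    exact lt_of_le_of_lt (le_abs_self _) h5
  have hnn : ∀ j i, 0 ≤ ((A ^ j) *ᵥ 1) i := by
    intro j
    induction j with
    | zero => intro i; simp
    | succ j ih =>
      intro i
      rw [pow_succ', ← Matrix.mulVec_mulVec, Matrix.mulVec, dotProduct]
      exact Finset.sum_nonneg fun k _ => mul_nonneg (hA i k) (ih k)
  -- Truncated Neumann series: `x - A x` telescopes to `1 - A ^ m 1`, which is positive because
  -- Gelfand's formula gave `‖A ^ m‖ < 1`.
  refine ⟨∑ j ∈ Finset.range m, (A ^ j) *ᵥ 1, fun i => ?_, fun i => ?_⟩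
  · rw [Finset.sum_apply]
    refine Finset.sum_pos' (fun j _ => hnn j i) ⟨0, Finset.mem_range.2 hm, by simp⟩
  · have h1 : A *ᵥ (∑ j ∈ Finset.range m, (A ^ j) *ᵥ 1) =
        ∑ j ∈ Finset.range m, (A ^ (j + 1)) *ᵥ (1 : Fin n → ℝ) := by
      rw [Matrix.mulVec_sum]
      simp [pow_succ']
    have h2 := Finset.sum_range_succ (fun j => ((A ^ j) *ᵥ (1 : Fin n → ℝ))) m
    rw [Finset.sum_range_succ', ← h1] at h2
    have h3 := congrFun h2 i
    have h4 := hsmall i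
    simp only [Pi.add_apply, pow_zero, Matrix.one_mulVec, Pi.one_apply] at h3
    linarith

/-- For an eigenvector `v`, take the row `i` maximizing `‖v i‖ / x i`: the eigenvalue equation there
bounds the eigenvalue's modulus by `(A x) i / x i < 1`. -/
theorem matrixSpectralRadius_lt_one_of_mulVec_lt {n : ℕ} [NeZero n]
    {A : Matrix (Fin n) (Fin n) ℝ} (hA : ∀ i k, 0 ≤ A i k) {x : Fin n → ℝ} (hx : ∀ i, 0 < x i)
    (hAx : ∀ i, (A *ᵥ x) i < x i) : matrixSpectralRadius A < 1 := by
  refine spectrum.spectralRadius_lt_of_forall_lt (r := 1) _ fun z hz => ?_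
  rw [← Matrix.spectrum_toLin', ← Module.End.hasEigenvalue_iff_mem_spectrum] at hz
  obtain ⟨v, hv⟩ := hz.exists_hasEigenvector
  have hAv := hv.apply_eq_smul
  obtain ⟨i, hi⟩ := Finite.exists_max fun i => ‖v i‖ / x i
  obtain ⟨l, hl⟩ := Function.ne_iff.1 hv.2
  have hM : 0 < ‖v i‖ / x i :=
    lt_of_lt_of_le (div_pos (norm_pos_iff.2 hl) (hx l)) (hi l)
  have hvi : 0 < ‖v i‖ := by
    have := mul_pos hM (hx i)
    rwa [div_mul_cancel₀ _ (hx i).ne'] at this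
  have hlt : ‖z‖ * ‖v i‖ < ‖v i‖ := by
    calc ‖z‖ * ‖v i‖ = ‖∑ k, (A i k : ℂ) * v k‖ := by
          have := congrFun hAv i
          rw [Matrix.toLin'_apply] at this
          simp only [Matrix.mulVec, dotProduct, Matrix.map_apply, Pi.smul_apply,
            smul_eq_mul] at this
          rw [this, norm_mul]
      _ ≤ ∑ k, A i k * ‖v k‖ := by
          refine (norm_sum_le _ _).trans (le_of_eq (Finset.sum_congr rfl fun k _ => ?_))
          rw [norm_mul, Complex.norm_real, Real.norm_of_nonneg (hA i k)]
      _ ≤ ∑ k, A i k * (‖v i‖ / x i * x k) := by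
          refine Finset.sum_le_sum fun k _ => mul_le_mul_of_nonneg_left ?_ (hA i k)
          exact (div_le_iff₀ (hx k)).1 (hi k)
      _ = ‖v i‖ / x i * (A *ᵥ x) i := by
          simp only [Matrix.mulVec, dotProduct, Finset.mul_sum]
          exact Finset.sum_congr rfl fun k _ => by ring
      _ < ‖v i‖ / x i * x i := mul_lt_mul_of_pos_left (hAx i) hM
      _ = ‖v i‖ := div_mul_cancel₀ _ (hx i).ne'
  have : ‖z‖ < 1 := by nlinarith
  exact_mod_cast this

theorem matrixSpectralRadius_lt_one_iff {n : ℕ} [NeZero n]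
    {A : Matrix (Fin n) (Fin n) ℝ} (hA : ∀ i k, 0 ≤ A i k) :
    matrixSpectralRadius A < 1 ↔
      ∃ x : Fin n → ℝ, (∀ i, 0 < x i) ∧ ∀ i, (A *ᵥ x) i < x i :=
  ⟨exists_pos_mulVec_lt_of_matrixSpectralRadius_lt_one hA,
    fun ⟨_, hx, hAx⟩ => matrixSpectralRadius_lt_one_of_mulVec_lt hA hx hAx⟩

end SpectralRadius

/-- If a nonnegative matrix with positive off-diagonal entries does not increase a positive vector
and strictly decreases one of its entries, then it strictly decreases all entries of some positive
vector. -/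
theorem Matrix.exists_pos_mulVec_lt_of_le {n : ℕ} {A : Matrix (Fin n) (Fin n) ℝ}
    (hA : ∀ i k, 0 ≤ A i k) (hA' : ∀ i k, i ≠ k → 0 < A i k) {x : Fin n → ℝ}
    (hx : ∀ i, 0 < x i) (hAx : ∀ i, (A *ᵥ x) i ≤ x i) {l : Fin n} (hl : (A *ᵥ x) l < x l) :
    ∃ z : Fin n → ℝ, (∀ i, 0 < z i) ∧ ∀ i, (A *ᵥ z) i < z i := by
  -- Lowering entry `l` to `t` keeps row `l` strict and makes every other row strict, since its
  -- entry in column `l` is positive.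
  obtain ⟨t, ht1, ht2⟩ := exists_between hl
  have h0 : 0 ≤ (A *ᵥ x) l := by
    rw [Matrix.mulVec, dotProduct]
    exact Finset.sum_nonneg fun k _ => mul_nonneg (hA l k) (hx k).le
  have hle : ∀ k, Function.update x l t k ≤ x k := by
    intro k
    rcases eq_or_ne k l with rfl | hk
    · simpa using ht2.le
    · simp [hk]
  have hmono : ∀ i k, A i k * Function.update x l t k ≤ A i k * x k := fun i k =>
    mul_le_mul_of_nonneg_left (hle k) (hA i k)
  refine ⟨Function.update x l t, fun i => ?_, fun i => ?_⟩
  · rcases eq_or_ne i l with rfl | hi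
    · simpa using h0.trans_lt ht1
    · simpa [hi] using hx i
  · rcases eq_or_ne i l with rfl | hi
    · rw [Function.update_self]
      refine lt_of_le_of_lt ?_ ht1
      simp only [Matrix.mulVec, dotProduct]
      exact Finset.sum_le_sum fun k _ => hmono i k
    · rw [Function.update_of_ne hi]
      refine lt_of_lt_of_le (Finset.sum_lt_sum (fun k _ => hmono i k)
        ⟨l, Finset.mem_univ _, ?_⟩) (hAx i)
      simpa using mul_lt_mul_of_pos_left ht2 (hA' i l hi)

/-! ### Coupling coefficients and feasibility -/

namespace CellularNetwork

variable {n : ℕ} (N : CellularNetwork n)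

/-- The coupling coefficients: the coupling matrix at unit demands. -/
noncomputable def coupling (i k : Fin n) : ℝ :=
  if i = k then 0 else ∑ j, N.gain k i j / N.gain i i j

theorem coupling_self (i : Fin n) : N.coupling i i = 0 := if_pos rfl

theorem coupling_pos {i k : Fin n} (h : i ≠ k) : 0 < N.coupling i k := by
  rw [coupling, if_neg h]
  exact Finset.sum_pos (fun j _ => div_pos (N.gain_pos _ _ _) (N.gain_pos _ _ _))
    ⟨⟨0, N.numUsers_pos i⟩, Finset.mem_univ _⟩

theorem coupling_nonneg (i k : Fin n) : 0 ≤ N.coupling i k := by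
  rcases eq_or_ne i k with rfl | h
  · exact (N.coupling_self i).ge
  · exact (N.coupling_pos h).le

theorem cellCouplingMatrix_apply (d : Fin n → ℝ) (i k : Fin n) :
    N.cellCouplingMatrix d i k = d i * N.coupling i k := by
  rw [cellCouplingMatrix, couplingMatrix, Matrix.of_apply, coupling]
  split_ifs
  · simp
  · rw [Finset.mul_sum]
    exact Finset.sum_congr rfl fun j _ => by ring

theorem cellCouplingMatrix_mulVec (d x : Fin n → ℝ) (i : Fin n) :
    (N.cellCouplingMatrix d *ᵥ x) i = d i * ∑ k, N.coupling i k * x k := by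
  simp only [Matrix.mulVec, dotProduct, cellCouplingMatrix_apply, Finset.mul_sum, mul_assoc]

theorem mem_feasibilitySet_iff [NeZero n] {u : Utility} {y : Fin n → ℝ} :
    y ∈ N.feasibilitySet u ↔ y ∈ u.vectors n ∧ ∃ x : Fin n → ℝ, (∀ i, 0 < x i) ∧
      ∀ i, u.g (y i) * ∑ k, N.coupling i k * x k < x i := by
  refine and_congr_right fun hy => ?_
  rw [matrixSpectralRadius_lt_one_iff]
  · simp only [cellCouplingMatrix_mulVec]
  · intro i k
    rw [cellCouplingMatrix_apply]
    exact mul_nonneg (u.mapsTo_g (hy i)).le (N.coupling_nonneg i k)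

/-! ### Linear utility -/

/-- Multiplying the two inequalities cancels `x 0 * x 1`; conversely only the ratio `t = x 0 / x 1`
matters, and the bound leaves room for one. -/
theorem mem_feasibilitySet_LIN_two_iff (N : CellularNetwork 2) {y : Fin 2 → ℝ} :
    y ∈ N.feasibilitySet .LIN ↔
      (0 < y 0 ∧ 0 < y 1) ∧ y 0 * y 1 * (N.coupling 0 1 * N.coupling 1 0) < 1 := by
  rw [mem_feasibilitySet_iff]
  simp only [Utility.vectors, Utility.range, Utility.g, Set.mem_ofPred_eq, Set.mem_Ioi,
    Fin.forall_fin_two, Fin.sum_univ_two, coupling_self, zero_mul, zero_add, add_zero]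
  have ha : 0 < N.coupling 0 1 := N.coupling_pos (by decide)
  have hb : 0 < N.coupling 1 0 := N.coupling_pos (by decide)
  generalize N.coupling 0 1 = a at *
  generalize N.coupling 1 0 = b at *
  refine and_congr_right fun ⟨h0, h1⟩ => ⟨?_, fun h => ?_⟩
  · rintro ⟨x, ⟨hx0, hx1⟩, h2, h3⟩
    have h4 : (y 0 * (a * x 1)) * (y 1 * (b * x 0)) < x 0 * x 1 :=
      mul_lt_mul'' h2 h3 (by positivity) (by positivity)
    have h5 : (y 0 * y 1 * (a * b)) * (x 0 * x 1) < 1 * (x 0 * x 1) := by linarith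
    exact lt_of_mul_lt_mul_right h5 (by positivity)
  · have h2 : y 0 * a < 1 / (y 1 * b) := by
      rw [lt_div_iff₀ (by positivity)]
      linarith
    obtain ⟨t, ht1, ht2⟩ := exists_between h2
    rw [lt_div_iff₀ (by positivity)] at ht2
    have ht : 0 < t := lt_trans (by positivity) ht1
    refine ⟨![t, 1], ?_, ?_⟩
    · simp [ht]
    · constructor
      · simpa using ht1
      · simp only [Matrix.cons_val_zero, Matrix.cons_val_one]
        linarith

theorem convex_infeasibilitySet_LIN_two (N : CellularNetwork 2) :
    Convex ℝ (N.infeasibilitySet .LIN) := by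
  have hc : 0 < N.coupling 0 1 * N.coupling 1 0 :=
    mul_pos (N.coupling_pos (by decide)) (N.coupling_pos (by decide))
  have key : N.infeasibilitySet .LIN =
      {y | (0 < y 0 ∧ 0 < y 1) ∧ 1 ≤ y 0 * y 1 * (N.coupling 0 1 * N.coupling 1 0)} := by
    ext y
    simp only [infeasibilitySet, Set.mem_sdiff, mem_feasibilitySet_LIN_two_iff, Set.mem_ofPred_eq,
      Utility.vectors, Utility.range, Set.mem_Ioi, Fin.forall_fin_two, not_and, not_lt]
    tauto
  rw [key]
  generalize N.coupling 0 1 * N.coupling 1 0 = c at *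
  rw [convex_iff_forall_pos]
  rintro x ⟨⟨hx0, hx1⟩, hx⟩ y ⟨⟨hy0, hy1⟩, hy⟩ a b ha hb hab
  simp only [Set.mem_ofPred_eq, Pi.add_apply, Pi.smul_apply, smul_eq_mul]
  refine ⟨⟨by positivity, by positivity⟩, ?_⟩
  -- The cross terms have the same product as the two diagonal terms, so AM-GM bounds their sum
  -- below by 2.
  have h1 : 1 ≤ (x 0 * y 1 * c) * (x 1 * y 0 * c) := by
    nlinarith [mul_le_mul hx hy zero_le_one (by positivity)]
  have h2 : 2 ≤ x 0 * y 1 * c + x 1 * y 0 * c := by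
    have : 0 < x 0 * y 1 * c + x 1 * y 0 * c := by positivity
    nlinarith [sq_nonneg (x 0 * y 1 * c - x 1 * y 0 * c)]
  have h3 : (a * x 0 + b * y 0) * (a * x 1 + b * y 1) * c =
      a ^ 2 * (x 0 * x 1 * c) + b ^ 2 * (y 0 * y 1 * c) +
        a * b * (x 0 * y 1 * c + x 1 * y 0 * c) := by ring
  have h4 : (1 : ℝ) = a ^ 2 * 1 + b ^ 2 * 1 + a * b * 2 := by
    have : (a + b) ^ 2 = 1 := by rw [hab]; norm_num
    linarith
  rw [h3, h4]
  gcongr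

/-- Two cells that couple each other with unit coefficients are infeasible at unit demands. -/
theorem mem_infeasibilitySet_LIN_of_coupled_pair [NeZero n] {p q : Fin n}
    (hpq : N.coupling p q = 1) (hqp : N.coupling q p = 1) {y : Fin n → ℝ} (hy : ∀ i, 0 < y i)
    (hp : y p = 1) (hq : y q = 1) : y ∈ N.infeasibilitySet .LIN := by
  refine ⟨hy, fun h => ?_⟩
  obtain ⟨-, x, hx, hlt⟩ := N.mem_feasibilitySet_iff.1 h
  simp only [Utility.g] at hlt
  have hle : ∀ i k, N.coupling i k * x k ≤ ∑ k, N.coupling i k * x k := fun i k =>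
    Finset.single_le_sum (f := fun k => N.coupling i k * x k)
      (fun k _ => mul_nonneg (N.coupling_nonneg i k) (hx k).le) (Finset.mem_univ k)
  have h1 := hlt p
  have h2 := hlt q
  have h3 := hle p q
  have h4 := hle q p
  rw [hp] at h1
  rw [hq] at h2
  rw [hpq] at h3
  rw [hqp] at h4
  linarith

/-- Any positive matrix of off-diagonal entries is the coupling matrix of some network with
prescribed numbers of users. -/
theorem exists_coupling_eq (m : Fin n → ℕ) (hm : ∀ i, 0 < m i) (C : Fin n → Fin n → ℝ)
    (hC : ∀ i k, 0 < C i k) :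
    ∃ N : CellularNetwork n, N.numUsers = m ∧ ∀ i k, i ≠ k → N.coupling i k = C i k := by
  have hm' : ∀ i, (0 : ℝ) < m i := fun i => by exact_mod_cast hm i
  -- Own gains are 1, and `C i k` is split evenly among the users of cell `i`.
  refine ⟨⟨m, hm, fun k i _ => if k = i then 1 else C i k / m i, fun k i j => ?_⟩, rfl, ?_⟩
  · split_ifs
    · exact one_pos
    · exact div_pos (hC i k) (hm' i)
  · intro i k h
    rw [coupling, if_neg h]
    simp only [if_neg h.symm, if_true, div_one, Finset.sum_const, Finset.card_univ,
      Fintype.card_fin, nsmul_eq_mul]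
    exact mul_div_cancel₀ _ (hm' i).ne'

/-- Cells 0, 1 and cells 2, 3 form strongly coupled pairs. Each of `p`, `q` overloads one pair, but
at their midpoint all demands are at most 11/20 and all row sums of the coupling at most 11/10, so
`x = 1` certifies feasibility. -/
theorem exists_not_convex_infeasibilitySet_LIN (hn : 4 ≤ n) (m : Fin n → ℕ)
    (hm : ∀ i, 0 < m i) :
    ∃ N : CellularNetwork n, N.numUsers = m ∧ ¬ Convex ℝ (N.infeasibilitySet .LIN) := by
  have : NeZero n := ⟨by omega⟩
  have hn0 : (0 : ℝ) < n := by exact_mod_cast (by omega : 0 < n)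
  -- A cell `i ≥ 4` is its own partner, hence only weakly coupled to the others.
  let partner : ℕ → ℕ := fun i => if i = 0 then 1 else if i = 1 then 0 else
    if i = 2 then 3 else if i = 3 then 2 else i
  have hε : (0 : ℝ) < 1 / (10 * n) := by positivity
  obtain ⟨N, hNm, hN⟩ := exists_coupling_eq m hm
    (fun i k => if (k : ℕ) = partner i then 1 else 1 / (10 * n))
    (fun i k => by split_ifs; exacts [one_pos, hε])
  refine ⟨N, hNm, fun hconv => ?_⟩
  let p : Fin n → ℝ := fun i => if (i : ℕ) < 2 then 1 else 1 / 10
  let q : Fin n → ℝ := fun i => if 2 ≤ (i : ℕ) ∧ (i : ℕ) < 4 then 1 else 1 / 10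
  have hp : p ∈ N.infeasibilitySet .LIN := by
    refine N.mem_infeasibilitySet_LIN_of_coupled_pair (p := ⟨0, by omega⟩) (q := ⟨1, by omega⟩)
      ?_ ?_ (fun i => ?_) ?_ ?_
    · rw [hN _ _ (by simp)]; simp [partner]
    · rw [hN _ _ (by simp)]; simp [partner]
    · dsimp only [p]; split_ifs <;> norm_num
    · simp [p]
    · simp [p]
  have hq : q ∈ N.infeasibilitySet .LIN := by
    refine N.mem_infeasibilitySet_LIN_of_coupled_pair (p := ⟨2, by omega⟩) (q := ⟨3, by omega⟩)
      ?_ ?_ (fun i => ?_) ?_ ?_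
    · rw [hN _ _ (by simp)]; simp [partner]
    · rw [hN _ _ (by simp)]; simp [partner]
    · dsimp only [q]; split_ifs <;> norm_num
    · simp [q]
    · simp [q]
  have hmid := hconv hp hq (a := 1 / 2) (b := 1 / 2) (by norm_num) (by norm_num) (by norm_num)
  refine hmid.2 (N.mem_feasibilitySet_iff.2 ⟨hmid.1, fun _ => 1, fun _ => one_pos, fun i => ?_⟩)
  have hsum : ∑ k, N.coupling i k * 1 ≤ 1 + 1 / 10 := by
    have hterm : ∀ k : Fin n,
        N.coupling i k * 1 ≤ (if (k : ℕ) = partner i then 1 else 0) + 1 / (10 * n) := by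
      intro k
      rcases eq_or_ne i k with rfl | h
      · rw [coupling_self]
        split_ifs <;> linarith
      · rw [hN i k h]
        split_ifs <;> linarith
    refine (Finset.sum_le_sum fun k _ => hterm k).trans ?_
    rw [Finset.sum_add_distrib]
    gcongr
    · rw [Finset.sum_boole]
      have : (Finset.univ.filter fun k : Fin n => (k : ℕ) = partner i).card ≤ 1 := by
        rw [Finset.card_le_one]
        intro a ha b hb
        simp only [Finset.mem_filter, Finset.mem_univ, true_and] at ha hb
        exact Fin.ext (ha.trans hb.symm)
      exact_mod_cast this
    · rw [Finset.sum_const, Finset.card_univ, Fintype.card_fin, nsmul_eq_mul]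
      apply le_of_eq
      field_simp
  have hd : p i + q i ≤ 1 + 1 / 10 := by
    dsimp only [p, q]
    split_ifs <;> first | omega | norm_num
  have hd0 : 0 ≤ p i + q i := by
    dsimp only [p, q]
    split_ifs <;> norm_num
  simp only [Utility.g, Pi.add_apply, Pi.smul_apply, smul_eq_mul]
  nlinarith [mul_le_mul_of_nonneg_left hsum hd0]

/-! ### Utilities with `log ∘ U⁻¹` convex -/

/-- The left-hand side of the feasibility condition of cell `i` in logarithmic coordinates. -/
noncomputable def logInterference (h : ℝ → ℝ) (y v : Fin n → ℝ) (i : Fin n) : ℝ :=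
  ∑ k, N.coupling i k * Real.exp (h (y i) + v k - v i)

theorem logInterference_log {h : ℝ → ℝ} {y x : Fin n → ℝ} (hx : ∀ i, 0 < x i) (i : Fin n) :
    N.logInterference h y (fun k => Real.log (x k)) i =
      (Real.exp (h (y i)) * ∑ k, N.coupling i k * x k) / x i := by
  simp only [logInterference, Real.exp_sub, Real.exp_add, Real.exp_log (hx _), Finset.mul_sum,
    Finset.sum_div]
  exact Finset.sum_congr rfl fun k _ => by ring

theorem logInterference_eq {h : ℝ → ℝ} {y v : Fin n → ℝ} (i : Fin n) :
    N.logInterference h y v i =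
      (Real.exp (h (y i)) * ∑ k, N.coupling i k * Real.exp (v k)) / Real.exp (v i) := by
  simpa using N.logInterference_log (h := h) (y := y) (fun k => Real.exp_pos (v k)) i

section LogConvex

variable {u : Utility} {h : ℝ → ℝ} (hu : u.range = Set.univ)
  (hg : ∀ t, u.g t = Real.exp (h t))
include hu hg

theorem mem_feasibilitySet_iff_exp [NeZero n] {y : Fin n → ℝ} :
    y ∈ N.feasibilitySet u ↔ ∃ x : Fin n → ℝ, (∀ i, 0 < x i) ∧
      ∀ i, Real.exp (h (y i)) * ∑ k, N.coupling i k * x k < x i := by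
  have hy : y ∈ u.vectors n := fun i => by rw [hu]; trivial
  rw [mem_feasibilitySet_iff, and_iff_right hy]
  simp only [hg]

theorem mem_feasibilitySet_iff_logInterference [NeZero n] {y : Fin n → ℝ} :
    y ∈ N.feasibilitySet u ↔ ∃ v : Fin n → ℝ, ∀ i, N.logInterference h y v i < 1 := by
  rw [N.mem_feasibilitySet_iff_exp hu hg]
  constructor
  · rintro ⟨x, hx, hlt⟩
    refine ⟨fun k => Real.log (x k), fun i => ?_⟩
    rw [N.logInterference_log hx, div_lt_one (hx i)]
    exact hlt i
  · rintro ⟨v, hv⟩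
    refine ⟨fun k => Real.exp (v k), fun k => Real.exp_pos _, fun i => ?_⟩
    have := hv i
    rwa [logInterference_eq, div_lt_one (Real.exp_pos _)] at this

/-- It is enough to have nonstrict inequalities, one of them strict. -/
theorem mem_feasibilitySet_of_logInterference_le [NeZero n] {y v : Fin n → ℝ}
    (hle : ∀ i, N.logInterference h y v i ≤ 1) {l : Fin n}
    (hlt : N.logInterference h y v l < 1) : y ∈ N.feasibilitySet u := by
  rw [N.mem_feasibilitySet_iff_exp hu hg]
  have key := Matrix.exists_pos_mulVec_lt_of_le
    (A := N.cellCouplingMatrix fun i => Real.exp (h (y i))) (x := fun k => Real.exp (v k)) (l := l)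
  simp only [cellCouplingMatrix_mulVec, cellCouplingMatrix_apply] at key
  refine key (fun i k => mul_nonneg (Real.exp_pos _).le (N.coupling_nonneg i k))
    (fun i k hik => mul_pos (Real.exp_pos _) (N.coupling_pos hik)) (fun k => Real.exp_pos _)
    (fun i => ?_) ?_
  · have := hle i
    rwa [logInterference_eq, div_le_one (Real.exp_pos _)] at this
  · rwa [logInterference_eq, div_lt_one (Real.exp_pos _)] at hlt

theorem isOpen_feasibilitySet [NeZero n] (hc : Continuous h) : IsOpen (N.feasibilitySet u) := by
  have key : N.feasibilitySet u =
      ⋃ v : Fin n → ℝ, ⋂ i, {y | N.logInterference h y v i < 1} := by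
    ext y
    simp [N.mem_feasibilitySet_iff_logInterference hu hg]
  rw [key]
  refine isOpen_iUnion fun v => isOpen_iInter_of_finite fun i => isOpen_lt ?_ continuous_const
  unfold logInterference
  fun_prop

/-- Certificates `x` normalized to the simplex have a convergent subsequence. The limit has some
positive entry, and positive coupling then forces all entries positive, so logarithms exist. -/
theorem exists_logInterference_le_of_mem_closure [NeZero n] (hc : Continuous h)
    {y : Fin n → ℝ} (hy : y ∈ closure (N.feasibilitySet u)) :
    ∃ v : Fin n → ℝ, ∀ i, N.logInterference h y v i ≤ 1 := by
  obtain ⟨Y, hY, hlim⟩ := mem_closure_iff_seq_limit.1 hy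
  have hX : ∀ m, ∃ x ∈ stdSimplex ℝ (Fin n),
      ∀ i, Real.exp (h (Y m i)) * ∑ k, N.coupling i k * x k ≤ x i := by
    intro m
    obtain ⟨x, hx, hlt⟩ := (N.mem_feasibilitySet_iff_exp hu hg).1 (hY m)
    have hs : 0 < ∑ i, x i := Finset.sum_pos (fun i _ => hx i) Finset.univ_nonempty
    refine ⟨fun i => x i / ∑ i, x i, ⟨fun i => (div_pos (hx i) hs).le, ?_⟩, fun i => ?_⟩
    · rw [← Finset.sum_div, div_self hs.ne']
    · rw [le_div_iff₀ hs]
      refine le_trans (le_of_eq ?_) (hlt i).le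
      rw [mul_assoc, Finset.sum_mul]
      congr 1
      refine Finset.sum_congr rfl fun k _ => ?_
      rw [mul_assoc, div_mul_cancel₀ _ hs.ne']
  choose X hXs hXle using hX
  obtain ⟨x, hx, φ, hφ, hxlim⟩ := (isCompact_stdSimplex ℝ (Fin n)).tendsto_subseq hXs
  have hYlim := hlim.comp hφ.tendsto_atTop
  have hle : ∀ i, Real.exp (h (y i)) * ∑ k, N.coupling i k * x k ≤ x i := by
    intro i
    have hYi : Tendsto (fun m => Y (φ m) i) atTop (𝓝 (y i)) := (tendsto_pi_nhds.1 hYlim) i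
    have hXi : ∀ k, Tendsto (fun m => X (φ m) k) atTop (𝓝 (x k)) := tendsto_pi_nhds.1 hxlim
    have hcont : Continuous fun t => Real.exp (h t) := Real.continuous_exp.comp hc
    refine le_of_tendsto_of_tendsto' (((hcont.tendsto (y i)).comp hYi).mul
      (tendsto_finsetSum _ fun k _ => (hXi k).const_mul (N.coupling i k))) (hXi i)
      fun m => hXle (φ m) i
  have hterm : ∀ i k, N.coupling i k * x k ≤ ∑ k, N.coupling i k * x k := fun i k =>
    Finset.single_le_sum (f := fun k => N.coupling i k * x k)
      (fun k _ => mul_nonneg (N.coupling_nonneg i k) (hx.1 k)) (Finset.mem_univ k)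
  obtain ⟨l, -, hl⟩ : ∃ l ∈ Finset.univ, 0 < x l := by
    by_contra! hcon
    have := Finset.sum_nonpos hcon
    rw [hx.2] at this
    linarith
  have hpos : ∀ i, 0 < x i := by
    intro i
    rcases eq_or_ne i l with rfl | hi
    · exact hl
    · refine lt_of_lt_of_le (mul_pos (Real.exp_pos _) ?_) (hle i)
      exact (mul_pos (N.coupling_pos hi) hl).trans_le (hterm i l)
  refine ⟨fun k => Real.log (x k), fun i => ?_⟩
  rw [N.logInterference_log hpos, div_le_one (hpos i)]
  exact hle i

omit hu hg in
-- The exponent is jointly convex in `(y, v)`, and `exp` is increasing and convex.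
theorem exp_log_coordinates_le (hh : ConvexOn ℝ Set.univ h) (y z v w : Fin n → ℝ) {a b : ℝ}
    (ha : 0 < a) (hb : 0 < b) (hab : a + b = 1) (i k : Fin n) :
    Real.exp (h ((a • y + b • z) i) + (a • v + b • w) k - (a • v + b • w) i) ≤
      a * Real.exp (h (y i) + v k - v i) + b * Real.exp (h (z i) + w k - w i) := by
  have h1 := hh.2 (Set.mem_univ (y i)) (Set.mem_univ (z i)) ha.le hb.le hab
  have h2 := convexOn_exp.2 (Set.mem_univ (h (y i) + v k - v i))
    (Set.mem_univ (h (z i) + w k - w i)) ha.le hb.le hab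
  simp only [Pi.add_apply, Pi.smul_apply, smul_eq_mul] at h1 h2 ⊢
  refine le_trans (Real.exp_le_exp.2 ?_) h2
  linarith

omit hu hg in
theorem logInterference_convex (hh : ConvexOn ℝ Set.univ h) (y z v w : Fin n → ℝ) {a b : ℝ}
    (ha : 0 < a) (hb : 0 < b) (hab : a + b = 1) (i : Fin n) :
    N.logInterference h (a • y + b • z) (a • v + b • w) i ≤
      a * N.logInterference h y v i + b * N.logInterference h z w i := by
  simp only [logInterference, Finset.mul_sum, ← Finset.sum_add_distrib]
  refine Finset.sum_le_sum fun k _ => ?_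
  have := mul_le_mul_of_nonneg_left (exp_log_coordinates_le hh y z v w ha hb hab i k)
    (N.coupling_nonneg i k)
  linarith

theorem convex_feasibilitySet [NeZero n] (hh : ConvexOn ℝ Set.univ h) :
    Convex ℝ (N.feasibilitySet u) := by
  rw [convex_iff_forall_pos]
  intro y hy z hz a b ha hb hab
  rw [N.mem_feasibilitySet_iff_logInterference hu hg] at hy hz ⊢
  obtain ⟨v, hv⟩ := hy
  obtain ⟨w, hw⟩ := hz
  refine ⟨a • v + b • w, fun i => ?_⟩
  have := N.logInterference_convex hh y z v w ha hb hab i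
  nlinarith [mul_lt_mul_of_pos_left (hv i) ha, mul_lt_mul_of_pos_left (hw i) hb]

/-- Strict convexity of the feasibility set, provided that at least one of the convexity
inequalities for off-diagonal terms is strict between any two distinct points. -/
theorem isStrictlyConvexRegion_feasibilitySet [NeZero n] (hc : Continuous h)
    (hh : ConvexOn ℝ Set.univ h)
    (hstrict : ∀ y z v w : Fin n → ℝ, y ≠ z → ∀ a b : ℝ, 0 < a → 0 < b → a + b = 1 →
      ∃ i k, i ≠ k ∧
        Real.exp (h ((a • y + b • z) i) + (a • v + b • w) k - (a • v + b • w) i) <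
          a * Real.exp (h (y i) + v k - v i) + b * Real.exp (h (z i) + w k - w i)) :
    IsStrictlyConvexRegion (N.feasibilitySet u) := by
  rintro y hy z hz hyz - ⟨a, b, ha, hb, hab, rfl⟩
  rw [(N.isOpen_feasibilitySet hu hg hc).interior_eq]
  obtain ⟨v, hv⟩ := N.exists_logInterference_le_of_mem_closure hu hg hc hy
  obtain ⟨w, hw⟩ := N.exists_logInterference_le_of_mem_closure hu hg hc hz
  have hle1 : ∀ i, a * N.logInterference h y v i + b * N.logInterference h z w i ≤ 1 :=
    fun i => by
      nlinarith [mul_le_mul_of_nonneg_left (hv i) ha.le, mul_le_mul_of_nonneg_left (hw i) hb.le]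
  obtain ⟨i, k, hik, hlt⟩ := hstrict y z v w hyz a b ha hb hab
  refine N.mem_feasibilitySet_of_logInterference_le hu hg (v := a • v + b • w) (l := i)
    (fun i => (N.logInterference_convex hh y z v w ha hb hab i).trans (hle1 i)) ?_
  refine lt_of_lt_of_le ?_ (hle1 i)
  simp only [logInterference, Finset.mul_sum, ← Finset.sum_add_distrib]
  refine Finset.sum_lt_sum (fun k _ => ?_) ⟨k, Finset.mem_univ k, ?_⟩
  · have := mul_le_mul_of_nonneg_left (exp_log_coordinates_le hh y z v w ha hb hab i k)
      (N.coupling_nonneg i k)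
    linarith
  · have := mul_lt_mul_of_pos_left hlt (N.coupling_pos hik)
    linarith

end LogConvex

theorem convex_feasibilitySet_LOG [NeZero n] : Convex ℝ (N.feasibilitySet .LOG) :=
  N.convex_feasibilitySet (h := id) rfl (fun _ => rfl) (convexOn_id convex_univ)

theorem isStrictlyConvexRegion_feasibilitySet_LOG (hn : 3 ≤ n) :
    IsStrictlyConvexRegion (N.feasibilitySet .LOG) := by
  have : NeZero n := ⟨by omega⟩
  refine N.isStrictlyConvexRegion_feasibilitySet (h := id) rfl (fun _ => rfl) continuous_id
    (convexOn_id convex_univ) fun y z v w hyz a b ha hb hab => ?_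
  -- Were all exponents equal, a third index `l` would give `v i - v k = w i - w k` from rows `(l,
  -- i)` and `(l, k)`, and then `y i = z i`. This is where `n ≥ 3` enters.
  obtain ⟨i, k, hik, hne⟩ : ∃ i k, i ≠ k ∧ y i + v k - v i ≠ z i + w k - w i := by
    by_contra! hcon
    refine hyz (funext fun i => ?_)
    have hex : ∀ s : Finset (Fin n), s.card ≤ 2 → ∃ l, l ∉ s := fun s hs => by
      by_contra! hall
      have := Finset.card_le_card (fun l _ => hall l : Finset.univ ⊆ s)
      rw [Finset.card_univ, Fintype.card_fin] at this
      omega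
    obtain ⟨k, hk⟩ := hex {i} (by simp)
    obtain ⟨l, hl⟩ := hex {i, k} Finset.card_le_two
    simp only [Finset.mem_insert, Finset.mem_singleton, not_or] at hk hl
    have h1 := hcon i k (Ne.symm hk)
    have h2 := hcon l i hl.1
    have h3 := hcon l k hl.2
    linarith
  refine ⟨i, k, hik, ?_⟩
  have := strictConvexOn_exp.2 (Set.mem_univ _) (Set.mem_univ _) hne ha hb hab
  simp only [id, Pi.add_apply, Pi.smul_apply, smul_eq_mul] at this ⊢
  refine lt_of_eq_of_lt ?_ this
  congr 1
  ring

end CellularNetwork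

/-! ### The `DLOG` utility -/

/-- The function `s ↦ s / (1 - exp (-s))`, written as `s * exp s / (exp s - 1)`, is strictly
increasing on the positive reals. -/
theorem mul_exp_div_exp_sub_one_strictMonoOn :
    StrictMonoOn (fun s : ℝ => s * Real.exp s / (Real.exp s - 1)) (Set.Ioi 0) := by
  intro s hs t ht hst
  have hs' : (0 : ℝ) < s := hs
  have ht' : (0 : ℝ) < t := ht
  have h1 : 0 < Real.exp s - 1 := by linarith [Real.add_one_lt_exp hs'.ne']
  have h2 : 0 < Real.exp t - 1 := by linarith [Real.add_one_lt_exp ht'.ne']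
  -- The reciprocal `(1 - exp (-s)) / s` is the slope of the secant of `exp` from `-s` to `0`.
  have hc := strictConvexOn_exp.secant_strict_mono (a := 0) (x := -t) (y := -s)
    (Set.mem_univ _) (Set.mem_univ _) (Set.mem_univ _) (by linarith) (by linarith) (by linarith)
  simp only [Real.exp_zero, sub_zero, Real.exp_neg] at hc
  rw [div_neg, div_neg, neg_lt_neg_iff, div_lt_div_iff₀ hs' ht'] at hc
  dsimp only
  rw [div_lt_div_iff₀ h1 h2]
  have hes := Real.exp_pos s
  have het := Real.exp_pos t
  have := mul_lt_mul_of_pos_right hc (mul_pos hes het)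
  have e1 : ((Real.exp s)⁻¹ - 1) * t * (Real.exp s * Real.exp t) =
      -(t * Real.exp t * (Real.exp s - 1)) := by field_simp; ring
  have e2 : ((Real.exp t)⁻¹ - 1) * s * (Real.exp s * Real.exp t) =
      -(s * Real.exp s * (Real.exp t - 1)) := by field_simp; ring
  linarith

theorem exp_exp_sub_one_pos (y : ℝ) : 0 < Real.exp (Real.exp y) - 1 := by
  linarith [Real.add_one_lt_exp (Real.exp_pos y).ne', Real.exp_pos y]

theorem continuous_log_exp_exp_sub_one :
    Continuous fun y : ℝ => Real.log (Real.exp (Real.exp y) - 1) :=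
  Continuous.log (by fun_prop) fun y => (exp_exp_sub_one_pos y).ne'

/-- The derivative is `s * exp s / (exp s - 1)` at `s = exp y`, a composition of strictly increasing
maps. -/
theorem strictConvexOn_log_exp_exp_sub_one :
    StrictConvexOn ℝ Set.univ fun y : ℝ => Real.log (Real.exp (Real.exp y) - 1) := by
  have hderiv : deriv (fun y : ℝ => Real.log (Real.exp (Real.exp y) - 1)) =
      fun y => (fun s : ℝ => s * Real.exp s / (Real.exp s - 1)) (Real.exp y) := by
    funext y
    have := (((Real.hasDerivAt_exp y).exp).sub_const 1).log (exp_exp_sub_one_pos y).ne'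
    rw [this.deriv]
    ring
  refine StrictMono.strictConvexOn_univ_of_deriv continuous_log_exp_exp_sub_one ?_
  rw [hderiv]
  exact fun s t hst => mul_exp_div_exp_sub_one_strictMonoOn (Real.exp_pos s) (Real.exp_pos t)
    (Real.exp_lt_exp.2 hst)

theorem CellularNetwork.isStrictlyConvexRegion_feasibilitySet_DLOG {n : ℕ}
    (N : CellularNetwork n) (hn : 2 ≤ n) : IsStrictlyConvexRegion (N.feasibilitySet .DLOG) := by
  have : NeZero n := ⟨by omega⟩
  have : Nontrivial (Fin n) := Fin.nontrivial_iff_two_le.2 hn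
  refine N.isStrictlyConvexRegion_feasibilitySet
    (h := fun y => Real.log (Real.exp (Real.exp y) - 1)) rfl
    (fun t => (Real.exp_log (exp_exp_sub_one_pos t)).symm) continuous_log_exp_exp_sub_one
    strictConvexOn_log_exp_exp_sub_one.convexOn fun y z v w hyz a b ha hb hab => ?_
  obtain ⟨i, hi⟩ := Function.ne_iff.1 hyz
  -- Strictness already comes from `h` at `y i ≠ z i`, so any second index serves and `n = 2` is
  -- enough.
  obtain ⟨k, hk⟩ := exists_ne i
  refine ⟨i, k, hk.symm, ?_⟩
  have h1 := strictConvexOn_log_exp_exp_sub_one.2 (Set.mem_univ _) (Set.mem_univ _) hi ha hb hab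
  have h2 := convexOn_exp.2
    (Set.mem_univ (Real.log (Real.exp (Real.exp (y i)) - 1) + v k - v i))
    (Set.mem_univ (Real.log (Real.exp (Real.exp (z i)) - 1) + w k - w i)) ha.le hb.le hab
  simp only [Pi.add_apply, Pi.smul_apply, smul_eq_mul] at h1 h2 ⊢
  refine lt_of_lt_of_le (Real.exp_lt_exp.2 ?_) h2
  linarith

theorem theorem3 :
    -- `LIN` utility, two base stations
    (∀ N : CellularNetwork 2, Convex ℝ (N.infeasibilitySet .LIN)) ∧
    -- `LIN` utility, more base stations: the complement is not convex in general
    (∀ n : ℕ, 4 ≤ n → ∀ m : Fin n → ℕ, (∀ i, 0 < m i) →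
      ∃ N : CellularNetwork n, N.numUsers = m ∧ ¬ Convex ℝ (N.infeasibilitySet .LIN)) ∧
    -- `LOG` utility
    (∀ N : CellularNetwork 2, Convex ℝ (N.feasibilitySet .LOG)) ∧
    (∀ n : ℕ, 3 ≤ n → ∀ N : CellularNetwork n,
      IsStrictlyConvexRegion (N.feasibilitySet .LOG)) ∧
    -- `DLOG` utility
    (∀ n : ℕ, 2 ≤ n → ∀ N : CellularNetwork n,
      IsStrictlyConvexRegion (N.feasibilitySet .DLOG)) := by
  exact ⟨CellularNetwork.convex_infeasibilitySet_LIN_two,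
    fun n hn m hm => CellularNetwork.exists_not_convex_infeasibilitySet_LIN hn m hm,
    fun N => N.convex_feasibilitySet_LOG,
    fun n hn N => N.isStrictlyConvexRegion_feasibilitySet_LOG hn,
    fun n hn N => N.isStrictlyConvexRegion_feasibilitySet_DLOG hn⟩
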